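/- A continuum is a nonempty compact connected metric space, and a subcontinuum of $X$ is a nonempty compact connected subset of $X$. A continuum $X$ is tree-like if for every $\varepsilon>0$ there are a (geometrically realized) finite tree $T$ and a continuous map $f:X\to T$ such that $\operatorname{diam} f^{-1}(t)<\varepsilon$ for every $t\in T$. A subcontinuum is indecomposable if it is not the union of two proper subcontinua of itself. The meager composant of a point $x\in X$ is $$M_x=\bigcup\{L\subset X: L \text{ is a nowhere dense subcontinuum of } X \text{ and } x\in L\},$$ where nowhere dense means nowhere dense in $X$. A dendrite is a locally connected continuum (up to choice of a compatible metric) that contains no homeomorphic copy of the circle; a single point is allowed. **Theorem.** Let $X$ be a tree-like continuum such that every indecomposable subcontinuum of $X$ is nowhere dense in $X$. Then there is a decomposition (partition) of $X$ whose elements are exactly the meager composants $M_x$, $x\in X$, and which is 1. monotone: each element is a subcontinuum of $X$; 2. upper semi-continuous: for every closed $A\subset X$ the union of all elements of the decomposition that meet $A$ is closed in $X$; and the decomposition space (the set of meager composants of $X$ with the quotient topology from $X$) is a dendrite. -/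

import Mathlib

open Set Topology

/-- A subcontinuum of a space: a (nonempty) compact connected subset. -/
def IsSubcontinuum {X : Type*} [TopologicalSpace X] (K : Set X) : Prop :=
  IsCompact K ∧ IsConnected K

/-- An indecomposable subcontinuum: a subcontinuum that is not the union of two
proper subcontinua of itself. -/
def IsIndecomposableSubcontinuum {X : Type*} [TopologicalSpace X] (K : Set X) : Prop :=
  IsSubcontinuum K ∧
    ¬ ∃ A B : Set X, IsSubcontinuum A ∧ IsSubcontinuum B ∧ A ⊂ K ∧ B ⊂ K ∧ A ∪ B = K

/-- The meager composant of `x`: the union of all nowhere dense subcontinua containing `x`. -/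
def meagerComposant {X : Type*} [TopologicalSpace X] (x : X) : Set X :=
  ⋃₀ {L : Set X | IsSubcontinuum L ∧ IsNowhereDense L ∧ x ∈ L}

/-- The geometric realization of a graph with vertex set `Fin n` as a subspace of `ℝⁿ`: vertices
are the standard basis vectors, edges are the segments joining adjacent ones
(`u = v` contributes the vertex itself). -/
def graphRealization {n : ℕ} (G : SimpleGraph (Fin n)) : Set (Fin n → ℝ) :=
  {p | ∃ u v : Fin n, (u = v ∨ G.Adj u v) ∧ p ∈ segment ℝ (Pi.single u 1) (Pi.single v 1)}

/-- A (compact connected) metric space is tree-like if for every `ε > 0` it has a continuous map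
to a finite tree all of whose fibres have diameter less than `ε`. -/
def IsTreeLike (X : Type*) [MetricSpace X] : Prop :=
  ∀ ε : ℝ, 0 < ε → ∃ (n : ℕ) (G : SimpleGraph (Fin n)) (f : X → graphRealization G),
    G.IsTree ∧ Continuous f ∧ ∀ t : graphRealization G, Metric.diam (f ⁻¹' {t}) < ε

/-- A dendrite: a locally connected (metrizable) continuum that contains no simple closed curve,
that is, no homeomorphic copy of the circle. -/
structure IsDendrite (Y : Type*) [TopologicalSpace Y] : Prop where
  metrizable : TopologicalSpace.MetrizableSpace Y
  compact : CompactSpace Y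
  connected : ConnectedSpace Y
  locallyConnected : LocallyConnectedSpace Y
  noSimpleClosedCurve : ¬ ∃ γ : Circle → Y, IsEmbedding γ

/-- A decomposition of `X`, given by the equivalence relation `s` whose classes are its elements,
is upper semi-continuous if for every closed set `A` the union of the elements that meet `A`
is closed. -/
def IsUpperSemicontinuousDecomposition {X : Type*} [TopologicalSpace X] (s : Setoid X) : Prop :=
  ∀ A : Set X, IsClosed A → IsClosed (⋃₀ {D | D ∈ s.classes ∧ (D ∩ A).Nonempty})

/-- A decomposition is monotone if each of its elements is a continuum. -/
def IsMonotoneDecomposition {X : Type*} [TopologicalSpace X] (s : Setoid X) : Prop :=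
  ∀ D ∈ s.classes, IsSubcontinuum D

/-! Connected subsets of a finite tree meet in connected sets, and maps to trees with small fibres
carry this back to `X`: a tree-like continuum is hereditarily unicoherent
(`IsTreeLike.hereditarilyUnicoherent`). Hence any two points x, y lie in a least continuum I, and y
∈ M_x exactly when I is nowhere dense.

Suppose y ∉ M_x. Then I contains a nonempty open set V, which no indecomposable continuum contains.
Thus I splits into two continua neither of which contains V (`exists_decomposition`), and from this
x and y get closed connected neighbourhoods H, K that miss a common nonempty open W ⊆ I
(`exists_nhds_of_notMem_meagerComposant`). For a continuum L from H to K, the union H ∪ L ∪ K joins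
x to y, so W ⊆ L and L is not nowhere dense. The relation y ∈ M_x is therefore closed.

Compactness then gives upper semi-continuity and a metrizable quotient. Hereditary unicoherence
passes to the monotone quotient and excludes circles. It also keeps finite intersections of closed
connected neighbourhoods connected, which yields local connectedness. -/

/-! ### Connected subsets of finite trees -/

/-- A set all of whose connected subsets intersect in connected sets. -/
def ConnectedInterClosed {E : Type*} [TopologicalSpace E] (S : Set E) : Prop :=
  ∀ A B : Set E, A ⊆ S → B ⊆ S → IsPreconnected A → IsPreconnected B → IsPreconnected (A ∩ B)

/-- `T` hangs on `S` at `p` only, so a separation of `A ∩ S` extends to one of `A` by adding `T` to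
the piece that contains `p`. -/
theorem IsPreconnected.inter_of_inter_eq_singleton {E : Type*} [TopologicalSpace E]
    {S T A : Set E} {p : E} (hS : IsClosed S) (hT : IsClosed T) (hST : S ∩ T = {p})
    (hA : A ⊆ S ∪ T) (hAc : IsPreconnected A) : IsPreconnected (A ∩ S) := by
  rcases (A ∩ T).eq_empty_or_nonempty with h | hT'
  · have : A ∩ S = A := inter_eq_left.2 fun z hz => (hA hz).resolve_right fun hzT =>
      (h.subset ⟨hz, hzT⟩ : z ∈ (∅ : Set E))
    rwa [this]
  rcases (A ∩ S).eq_empty_or_nonempty with h | hS'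
  · rw [h]; exact isPreconnected_empty
  have hp : p ∈ A := by
    obtain ⟨z, hzA, hz⟩ := isPreconnected_closed_iff.1 hAc S T hS hT hA hS' hT'
    rw [hST] at hz
    rwa [← mem_singleton_iff.1 hz]
  have hpST : p ∈ S ∩ T := by rw [hST]; rfl
  have key : ∀ u v : Set E, IsClosed u → IsClosed v → A ∩ S ⊆ u ∪ v →
      A ∩ S ∩ (u ∩ v) = ∅ → p ∈ u → A ∩ S ⊆ u := by
    intro u v hu hv huv hd hpu
    have h1 := isPreconnected_iff_subset_of_disjoint_closed.1 hAc (u ∩ S ∪ T) (v ∩ S)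
      ((hu.inter hS).union hT) (hv.inter hS) ?_ ?_
    · rcases h1 with h1 | h1
      · rintro z ⟨hzA, hzS⟩
        rcases h1 hzA with h2 | h2
        · exact h2.1
        · have : z ∈ S ∩ T := ⟨hzS, h2⟩
          rw [hST] at this
          rwa [mem_singleton_iff.1 this]
      · exact ((eq_empty_iff_forall_notMem.1 hd p) ⟨⟨hp, hpST.1⟩, hpu, (h1 hp).1⟩).elim
    · intro z hz
      rcases hA hz with h2 | h2
      · rcases huv ⟨hz, h2⟩ with h3 | h3
        · exact Or.inl (Or.inl ⟨h3, h2⟩)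
        · exact Or.inr ⟨h3, h2⟩
      · exact Or.inl (Or.inr h2)
    · rw [eq_empty_iff_forall_notMem]
      rintro z ⟨hzA, h2 | h2, h3⟩
      · exact eq_empty_iff_forall_notMem.1 hd z ⟨⟨hzA, h2.2⟩, h2.1, h3.1⟩
      · have : z ∈ S ∩ T := ⟨h3.2, h2⟩
        rw [hST, mem_singleton_iff] at this
        subst this
        exact eq_empty_iff_forall_notMem.1 hd z ⟨⟨hzA, h3.2⟩, hpu, h3.1⟩
  rw [isPreconnected_iff_subset_of_disjoint_closed]
  intro u v hu hv huv hd
  rcases huv ⟨hp, hpST.1⟩ with h | h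
  · exact Or.inl (key u v hu hv huv hd h)
  · exact Or.inr (key v u hv hu (by rwa [union_comm]) (by rwa [inter_comm v]) h)

/-- The traces of `A ∩ B` on `S` and on `T` are connected; if both are nonempty, then `A` and `B`
each pass through `p`, which joins the traces. -/
theorem ConnectedInterClosed.union {E : Type*} [TopologicalSpace E] {S T : Set E} {p : E}
    (hS : IsClosed S) (hT : IsClosed T) (hST : S ∩ T = {p})
    (hS' : ConnectedInterClosed S) (hT' : ConnectedInterClosed T) :
    ConnectedInterClosed (S ∪ T) := by
  intro A B hA hB hAc hBc
  have hTS : T ∩ S = {p} := by rw [inter_comm, hST]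
  have hpST : p ∈ S ∩ T := by rw [hST]; rfl
  have h1 := hS' _ _ inter_subset_right inter_subset_right
    (hAc.inter_of_inter_eq_singleton hS hT hST hA) (hBc.inter_of_inter_eq_singleton hS hT hST hB)
  have h2 := hT' _ _ inter_subset_right inter_subset_right
    (hAc.inter_of_inter_eq_singleton hT hS hTS (by rwa [union_comm]))
    (hBc.inter_of_inter_eq_singleton hT hS hTS (by rwa [union_comm]))
  have hmeet : ∀ C : Set E, C ⊆ S ∪ T → IsPreconnected C → (C ∩ S).Nonempty →
      (C ∩ T).Nonempty → p ∈ C := by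
    intro C hC hCc h3 h4
    obtain ⟨z, hz, hz'⟩ := isPreconnected_closed_iff.1 hCc S T hS hT hC h3 h4
    rw [hST] at hz'
    rwa [← mem_singleton_iff.1 hz']
  have hunion : A ∩ B = (A ∩ S) ∩ (B ∩ S) ∪ (A ∩ T) ∩ (B ∩ T) := by
    ext z
    constructor
    · rintro ⟨hzA, hzB⟩
      rcases hA hzA with h | h
      · exact Or.inl ⟨⟨hzA, h⟩, hzB, h⟩
      · exact Or.inr ⟨⟨hzA, h⟩, hzB, h⟩
    · rintro (⟨h, h'⟩ | ⟨h, h'⟩) <;> exact ⟨h.1, h'.1⟩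
  rw [hunion]
  rcases ((A ∩ S) ∩ (B ∩ S)).eq_empty_or_nonempty with h | ⟨z, hzA, hzB⟩
  · rwa [h, empty_union]
  rcases ((A ∩ T) ∩ (B ∩ T)).eq_empty_or_nonempty with h | ⟨w, hwA, hwB⟩
  · rwa [h, union_empty]
  have hpA := hmeet A hA hAc ⟨z, hzA⟩ ⟨w, hwA⟩
  have hpB := hmeet B hB hBc ⟨z, hzB⟩ ⟨w, hwB⟩
  exact IsPreconnected.union p ⟨⟨hpA, hpST.1⟩, hpB, hpST.1⟩ ⟨⟨hpA, hpST.2⟩, hpB, hpST.2⟩ h1 h2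

theorem connectedInterClosed_of_leftInverse {E : Type*} [TopologicalSpace E] {S : Set E}
    {c : E → ℝ} {φ : ℝ → E} (hc : Continuous c) (hφ : Continuous φ)
    (h : ∀ z ∈ S, φ (c z) = z) : ConnectedInterClosed S := by
  intro A B hA hB hAc hBc
  have h1 := (hAc.image c hc.continuousOn).ordConnected
  have h2 := (hBc.image c hc.continuousOn).ordConnected
  have : A ∩ B = φ '' (c '' A ∩ c '' B) := by
    ext z
    constructor
    · rintro ⟨hzA, hzB⟩
      exact ⟨c z, ⟨⟨z, hzA, rfl⟩, ⟨z, hzB, rfl⟩⟩, h z (hA hzA)⟩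
    · rintro ⟨t, ⟨⟨a, ha, rfl⟩, ⟨b, hb, hab⟩⟩, rfl⟩
      have : a = b := by rw [← h a (hA ha), ← h b (hB hb), hab]
      rw [h a (hA ha)]
      exact ⟨ha, this ▸ hb⟩
  rw [this]
  exact (h1.inter h2).isPreconnected.image φ hφ.continuousOn

theorem Set.Subsingleton.connectedInterClosed {E : Type*} [TopologicalSpace E] {S : Set E}
    (hS : S.Subsingleton) : ConnectedInterClosed S := fun _ _ hA _ _ _ =>
  (hS.anti (inter_subset_left.trans hA)).isPreconnected

theorem mem_segment_single_iff {n : ℕ} {i j : Fin n} {p : Fin n → ℝ} :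
    p ∈ segment ℝ (Pi.single i 1) (Pi.single j 1) ↔
      ∃ t ∈ Icc (0 : ℝ) 1, AffineMap.lineMap (Pi.single i 1 : Fin n → ℝ) (Pi.single j 1) t = p := by
  rw [segment_eq_image_lineMap]; rfl

theorem lineMap_single_apply_right {n : ℕ} {i j : Fin n} (hij : i ≠ j) (t : ℝ) :
    AffineMap.lineMap (Pi.single i 1 : Fin n → ℝ) (Pi.single j 1) t j = t := by
  simp [AffineMap.lineMap_apply, hij.symm]

theorem connectedInterClosed_segment_single {n : ℕ} {i j : Fin n} (hij : i ≠ j) :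
    ConnectedInterClosed (segment ℝ (Pi.single i 1 : Fin n → ℝ) (Pi.single j 1)) := by
  refine connectedInterClosed_of_leftInverse (c := fun p => p j)
    (φ := fun t => AffineMap.lineMap (Pi.single i 1 : Fin n → ℝ) (Pi.single j 1) t)
    (continuous_apply j) (AffineMap.lineMap_continuous) ?_
  intro z hz
  obtain ⟨t, -, rfl⟩ := mem_segment_single_iff.1 hz
  simp only [lineMap_single_apply_right hij]

/-- The realization of a graph whose vertices are placed at standard basis vectors. -/
def placedRealization {V : Type*} {n : ℕ} (G : SimpleGraph V) (φ : V → Fin n) :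
    Set (Fin n → ℝ) :=
  {p | ∃ u v : V, (u = v ∨ G.Adj u v) ∧ p ∈ segment ℝ (Pi.single (φ u) 1) (Pi.single (φ v) 1)}

theorem isClosed_segment_single {n : ℕ} (i j : Fin n) :
    IsClosed (segment ℝ (Pi.single i 1 : Fin n → ℝ) (Pi.single j 1)) := by
  rw [segment_eq_image_lineMap]
  exact (isCompact_Icc.image AffineMap.lineMap_continuous).isClosed

theorem isClosed_placedRealization {V : Type*} [Finite V] {n : ℕ} (G : SimpleGraph V)
    (φ : V → Fin n) : IsClosed (placedRealization G φ) := by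
  have : placedRealization G φ = ⋃ e ∈ {e : V × V | e.1 = e.2 ∨ G.Adj e.1 e.2},
      segment ℝ (Pi.single (φ e.1) 1 : Fin n → ℝ) (Pi.single (φ e.2) 1) := by
    ext p
    simp [placedRealization]
  rw [this]
  exact (Set.toFinite _).isClosed_biUnion fun e _ => isClosed_segment_single _ _

theorem segment_single_apply_eq_zero {n : ℕ} {i j k : Fin n} (hi : i ≠ k) (hj : j ≠ k)
    {p : Fin n → ℝ} (hp : p ∈ segment ℝ (Pi.single i 1) (Pi.single j 1)) : p k = 0 := by
  obtain ⟨t, -, rfl⟩ := mem_segment_single_iff.1 hp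
  simp [AffineMap.lineMap_apply, hi.symm, hj.symm]

/-- Induction on the number of vertices: removing a leaf leaves a smaller tree with a segment
attached at one point. The placement `φ` keeps the ambient `ℝⁿ` fixed while the vertex set shrinks.
-/
theorem connectedInterClosed_placedRealization {n : ℕ} (k : ℕ) :
    ∀ {V : Type} [Fintype V] (G : SimpleGraph V) (φ : V → Fin n), Fintype.card V = k →
      G.IsTree → Function.Injective φ → ConnectedInterClosed (placedRealization G φ) := by
  classical
  induction k with
  | zero =>
    intro V _ G φ hk hG hφ
    have := hG.connected.nonempty
    exact absurd hk Fintype.card_ne_zero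
  | succ k ih =>
    intro V _ G φ hk hG hφ
    rcases subsingleton_or_nontrivial V with hV | hV
    · refine Set.Subsingleton.connectedInterClosed ?_
      rintro p ⟨u, v, -, hp⟩ q ⟨u', v', -, hq⟩
      rw [Subsingleton.elim v u, segment_same, mem_singleton_iff] at hp
      rw [Subsingleton.elim u' u, Subsingleton.elim v' u, segment_same, mem_singleton_iff] at hq
      rw [hp, hq]
    obtain ⟨v, hv⟩ := hG.exists_vert_degree_one_of_nontrivial
    obtain ⟨u, huv, hu⟩ := SimpleGraph.degree_eq_one_iff_existsUnique_adj.1 hv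
    have hne : u ≠ v := fun h => G.ne_of_adj huv h.symm
    have hφuv : φ u ≠ φ v := hφ.ne hne
    have htree : (G.induce {v}ᶜ).IsTree :=
      ⟨hG.connected.induce_compl_singleton_of_degree_eq_one hv, hG.isAcyclic.induce _⟩
    have hcard : Fintype.card ({v}ᶜ : Set V) = k := by
      rw [Fintype.card_compl_set]; simp [hk]
    have hunion : placedRealization G φ =
        placedRealization (G.induce {v}ᶜ) (fun w => φ w.1) ∪
          segment ℝ (Pi.single (φ u) 1) (Pi.single (φ v) 1) := by
      ext p
      constructor
      · rintro ⟨a, b, hab, hp⟩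
        by_cases ha : a = v
        · subst ha
          right
          rcases hab with rfl | hab
          · rw [segment_same, mem_singleton_iff] at hp
            rw [hp]; exact right_mem_segment _ _ _
          · rw [hu b hab] at hp
            rwa [segment_symm]
        by_cases hb : b = v
        · subst hb
          right
          rcases hab with rfl | hab
          · exact absurd rfl ha
          · rwa [hu a hab.symm] at hp
        left
        refine ⟨⟨a, ha⟩, ⟨b, hb⟩, ?_, hp⟩
        rcases hab with rfl | hab
        · exact Or.inl rfl
        · exact Or.inr hab
      · rintro (⟨a, b, hab, hp⟩ | hp)
        · refine ⟨a, b, ?_, hp⟩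
          rcases hab with rfl | hab
          · exact Or.inl rfl
          · exact Or.inr hab
        · exact ⟨u, v, Or.inr huv.symm, hp⟩
    rw [hunion]
    refine ConnectedInterClosed.union (p := Pi.single (φ u) 1) (isClosed_placedRealization _ _)
      (isClosed_segment_single _ _) ?_
      (ih _ _ hcard htree (hφ.comp Subtype.val_injective))
      (connectedInterClosed_segment_single hφuv)
    ext p
    constructor
    -- The coordinate of the leaf vanishes on the smaller tree and is the parameter of the segment,
    -- so only the end at `u` is shared.
    · rintro ⟨⟨a, b, -, hp⟩, hp'⟩
      have h0 := segment_single_apply_eq_zero (hφ.ne a.2) (hφ.ne b.2) hp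
      obtain ⟨t, -, rfl⟩ := mem_segment_single_iff.1 hp'
      rw [lineMap_single_apply_right hφuv] at h0
      simp [h0]
    · rintro rfl
      exact ⟨⟨⟨u, hne⟩, ⟨u, hne⟩, Or.inl rfl, left_mem_segment _ _ _⟩, left_mem_segment _ _ _⟩

/-! ### Tree-like continua are hereditarily unicoherent -/

/-- A space is hereditarily unicoherent if any two closed connected subsets have connected
intersection. -/
def HereditarilyUnicoherent (X : Type*) [TopologicalSpace X] : Prop :=
  ∀ A B : Set X, IsClosed A → IsClosed B → IsPreconnected A → IsPreconnected B →
    IsPreconnected (A ∩ B)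

open Metric in
-- If `A ∩ B` split into `u` and `v`, take a map to a tree whose fibres are too small to join the
-- thickenings of `u` and `v`, or to join `B` to a point of `A` far from `u ∪ v`. The images of the
-- thickenings then cover the connected set `g '' A ∩ g '' B`, so they meet, which is impossible.
theorem IsTreeLike.hereditarilyUnicoherent {X : Type*} [MetricSpace X] [CompactSpace X]
    (hX : IsTreeLike X) : HereditarilyUnicoherent X := by
  intro A B hA hB hAc hBc
  rw [isPreconnected_iff_subset_of_fully_disjoint_closed (hA.inter hB)]
  intro u v hu hv huv hd
  by_contra! hcon
  obtain ⟨hnu, hnv⟩ := hcon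
  obtain ⟨q, hqAB, hqu⟩ := not_subset.1 hnu
  obtain ⟨p, hpAB, hpv⟩ := not_subset.1 hnv
  have hpu := (huv hpAB).resolve_right hpv
  have hqv := (huv hqAB).resolve_left hqu
  obtain ⟨δ, hδ, hdis⟩ := hd.exists_cthickenings hu.isCompact hv
  obtain ⟨r, hr, hr'⟩ := Metric.exists_pos_forall_lt_edist
    (s := cthickening δ u) (t := cthickening δ v)
    isClosed_cthickening.isCompact isClosed_cthickening hdis
  obtain ⟨r₂, hr₂, hr₂'⟩ := Metric.exists_pos_forall_lt_edist
    (s := A \ thickening δ (u ∪ v)) (t := B)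
    (hA.sdiff isOpen_thickening).isCompact hB (by
      rw [Set.disjoint_left]
      rintro z ⟨hzA, hz⟩ hzB
      exact hz (self_subset_thickening hδ _ (huv ⟨hzA, hzB⟩)))
  obtain ⟨n, G, f, hG, hf, hfib⟩ := hX (min r r₂) (lt_min hr hr₂)
  set g : X → (Fin n → ℝ) := fun x => (f x : Fin n → ℝ) with hg
  have hgc : Continuous g := continuous_subtype_val.comp hf
  have hedist : ∀ x y, g x = g y → edist x y ≤ r ∧ edist x y ≤ r₂ := by
    intro x y hxy
    have h1 : dist x y < min (r : ℝ) r₂ :=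
      (Metric.dist_le_diam_of_mem Metric.isBounded_of_compactSpace
        (show x ∈ f ⁻¹' {f y} from Subtype.ext hxy) (show y ∈ f ⁻¹' {f y} from rfl)).trans_lt
        (hfib _)
    rw [lt_min_iff] at h1
    constructor
    · rw [edist_nndist]
      exact_mod_cast h1.1.le
    · rw [edist_nndist]
      exact_mod_cast h1.2.le
  have hmem : ∀ z, g z ∈ placedRealization G id := fun z => (f z).2
  have hconn : IsPreconnected (g '' A ∩ g '' B) :=
    connectedInterClosed_placedRealization n G id (Fintype.card_fin n) hG Function.injective_id
      _ _ (by rintro _ ⟨z, -, rfl⟩; exact hmem z) (by rintro _ ⟨z, -, rfl⟩; exact hmem z)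
      (hAc.image g hgc.continuousOn) (hBc.image g hgc.continuousOn)
  have hclosed : ∀ C : Set X, IsClosed C → IsClosed (g '' C) := fun C hC =>
    (hC.isCompact.image hgc).isClosed
  obtain ⟨w, -, ⟨a, ha, rfl⟩, ⟨b, hb, hab⟩⟩ := isPreconnected_closed_iff.1 hconn
    (g '' cthickening δ u) (g '' cthickening δ v)
    (hclosed _ isClosed_cthickening) (hclosed _ isClosed_cthickening)
    (by
      rintro _ ⟨⟨a, ha, rfl⟩, ⟨b, hb, hab⟩⟩
      have h1 : a ∈ thickening δ (u ∪ v) := by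
        by_contra hna
        exact absurd (hr₂' a ⟨ha, hna⟩ b hb) (not_lt.2 (hedist a b hab.symm).2)
      rw [thickening_union] at h1
      rcases h1 with h1 | h1
      · exact Or.inl ⟨a, thickening_subset_cthickening _ _ h1, rfl⟩
      · exact Or.inr ⟨a, thickening_subset_cthickening _ _ h1, rfl⟩)
    ⟨g p, ⟨⟨p, hpAB.1, rfl⟩, ⟨p, hpAB.2, rfl⟩⟩, ⟨p, self_subset_cthickening u hpu, rfl⟩⟩
    ⟨g q, ⟨⟨q, hqAB.1, rfl⟩, ⟨q, hqAB.2, rfl⟩⟩, ⟨q, self_subset_cthickening v hqv, rfl⟩⟩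
  exact absurd (hr' a ha b hb) (not_lt.2 (hedist a b hab.symm).1)

/-! ### Components, separations and irreducible continua -/

theorem isClosed_connectedComponentIn_of_isClosed {X : Type*} [TopologicalSpace X] {F : Set X}
    (hF : IsClosed F) (x : X) : IsClosed (connectedComponentIn F x) := by
  by_cases hx : x ∈ F
  · refine isClosed_of_closure_subset ?_
    exact isPreconnected_connectedComponentIn.closure.subset_connectedComponentIn
      (subset_closure (mem_connectedComponentIn hx))
      (closure_minimal (connectedComponentIn_subset F x) hF)
  · rw [connectedComponentIn_eq_empty hx]; exact isClosed_empty

/-- Points of a closed set in a compact Hausdorff space that lie in different components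
are separated by a partition into two closed sets. -/
theorem exists_isClosed_partition_of_notMem_connectedComponentIn {X : Type*} [TopologicalSpace X]
    [CompactSpace X] [T2Space X] {F : Set X} (hF : IsClosed F) {x y : X} (hx : x ∈ F) (hy : y ∈ F)
    (hxy : y ∉ connectedComponentIn F x) :
    ∃ S T : Set X, IsClosed S ∧ IsClosed T ∧ Disjoint S T ∧ S ∪ T = F ∧ x ∈ S ∧ y ∈ T := by
  have := hF.isCompact
  have : CompactSpace F := isCompact_iff_compactSpace.1 this
  have h1 : (⟨y, hy⟩ : F) ∉ connectedComponent (⟨x, hx⟩ : F) := by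
    intro h
    rw [connectedComponentIn_eq_image hx] at hxy
    exact hxy ⟨_, h, rfl⟩
  rw [connectedComponent_eq_iInter_isClopen, mem_iInter] at h1
  push Not at h1
  obtain ⟨⟨s, hs, hxs⟩, hys⟩ := h1
  refine ⟨(↑) '' s, (↑) '' sᶜ, hF.isClosedMap_subtype_val _ hs.1,
    hF.isClosedMap_subtype_val _ hs.compl.1, ?_, ?_, ⟨_, hxs, rfl⟩, ⟨_, hys, rfl⟩⟩
  · exact disjoint_image_of_injective Subtype.val_injective disjoint_compl_right
  · rw [← image_union, union_compl_self, image_univ, Subtype.range_coe]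

/-- In a separation of `I \ v ∪ P`, the piece disjoint from `P` stays separated from everything else
in `I` once the other side `I \ u` is added to the piece containing `P`. -/
theorem IsPreconnected.diff_union_of_separation {X : Type*} [TopologicalSpace X] {I P u v : Set X}
    (hI : IsClosed I) (hIc : IsPreconnected I) (hP : IsClosed P) (hPc : IsPreconnected P)
    (hPne : P.Nonempty) (hPI : P ⊆ I) (hu : IsOpen u) (hv : IsOpen v) (huv : I \ P ⊆ u ∪ v)
    (hd : (I \ P) ∩ (u ∩ v) = ∅) : IsPreconnected (I \ v ∪ P) := by
  have hS : IsClosed (I \ v ∪ P) := (hI.sdiff hv).union hP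
  have key : ∀ a b : Set X, IsClosed a → IsClosed b → I \ v ∪ P ⊆ a ∪ b → Disjoint a b →
      P ⊆ a → I \ v ∪ P ⊆ a := by
    intro a b ha hb hab hdab hPa
    obtain ⟨p, hp⟩ := hPne
    have h1 := isPreconnected_iff_subset_of_disjoint_closed.1 hIc
      ((I \ v ∪ P) ∩ a ∪ (I \ u ∪ P)) ((I \ v ∪ P) ∩ b)
      ((hS.inter ha).union ((hI.sdiff hu).union hP)) (hS.inter hb) ?_ ?_
    · rcases h1 with h1 | h1
      · intro z hz
        have hzI : z ∈ I := hz.elim (fun h => h.1) (fun h => hPI h)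
        rcases h1 hzI with h2 | h2
        · exact h2.2
        · rcases h2 with h2 | h2
          · rcases hz with hz | hz
            · by_contra hza
              have hzP : z ∉ P := fun h => hza (hPa h)
              exact (huv ⟨hzI, hzP⟩).elim h2.2 hz.2
            · exact hPa hz
          · exact hPa h2
      · exact (Set.disjoint_left.1 hdab (hPa hp) (h1 (hPI hp)).2).elim
    · intro z hz
      by_cases hzP : z ∈ P
      · exact Or.inl (Or.inr (Or.inr hzP))
      by_cases hzu : z ∈ u
      · have hzv : z ∉ v := fun h => eq_empty_iff_forall_notMem.1 hd z ⟨⟨hz, hzP⟩, hzu, h⟩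
        have hzS : z ∈ I \ v ∪ P := Or.inl ⟨hz, hzv⟩
        rcases hab hzS with h | h
        · exact Or.inl (Or.inl ⟨hzS, h⟩)
        · exact Or.inr ⟨hzS, h⟩
      · exact Or.inl (Or.inr (Or.inl ⟨hz, hzu⟩))
    · rw [eq_empty_iff_forall_notMem]
      rintro z ⟨hzI, h2 | h2, h3⟩
      · exact Set.disjoint_left.1 hdab h2.2 h3.2
      · have hzP : z ∉ P := fun h => Set.disjoint_left.1 hdab (hPa h) h3.2
        have hzu := (h2.resolve_right hzP).2
        have hzv := (h3.1.resolve_right hzP).2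
        exact (huv ⟨hzI, hzP⟩).elim hzu hzv
  rw [isPreconnected_iff_subset_of_fully_disjoint_closed hS]
  intro a b ha hb hab hdab
  have hPab : P ⊆ a ∨ P ⊆ b :=
    isPreconnected_iff_subset_of_fully_disjoint_closed hP |>.1 hPc a b ha hb
      (subset_union_right.trans hab) hdab
  rcases hPab with h | h
  · exact Or.inl (key a b ha hb hab hdab h)
  · exact Or.inr (key b a hb ha (by rwa [union_comm b]) hdab.symm h)

/-- A closed connected set that is irreducible between two of its points. -/
structure IrreducibleBetween {X : Type*} [TopologicalSpace X] (I : Set X) (x y : X) : Prop where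
  isClosed : IsClosed I
  isPreconnected : IsPreconnected I
  left_mem : x ∈ I
  right_mem : y ∈ I
  minimal : ∀ K ⊆ I, IsClosed K → IsPreconnected K → x ∈ K → y ∈ K → I ⊆ K

namespace IrreducibleBetween

variable {X : Type*} [TopologicalSpace X] {I : Set X} {x y : X}

theorem symm (h : IrreducibleBetween I x y) : IrreducibleBetween I y x :=
  ⟨h.1, h.2, h.4, h.3, fun K hK hKc hKp hy hx => h.5 K hK hKc hKp hx hy⟩

/-- Were `I \ P` separated, `P` together with the part containing `y` would be a smaller continuum
from `x` to `y`. -/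
theorem isPreconnected_diff (h : IrreducibleBetween I x y) {P : Set X} (hP : IsClosed P)
    (hPc : IsPreconnected P) (hPI : P ⊆ I) (hx : x ∈ P) (hy : y ∉ P) :
    IsPreconnected (I \ P) := by
  have key : ∀ u v : Set X, IsOpen u → IsOpen v → I \ P ⊆ u ∪ v → (I \ P) ∩ (u ∩ v) = ∅ →
      y ∉ v → I \ P ⊆ u := by
    intro u v hu hv huv hd hyv
    have h1 := IsPreconnected.diff_union_of_separation h.isClosed h.isPreconnected hP hPc ⟨x, hx⟩
      hPI hu hv huv hd
    have h2 := h.minimal _ (union_subset sdiff_subset hPI) ((h.isClosed.sdiff hv).union hP) h1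
      (Or.inr hx) (Or.inl ⟨h.right_mem, hyv⟩)
    intro z hz
    refine (huv hz).resolve_right fun hzv => ?_
    rcases h2 hz.1 with h3 | h3
    · exact h3.2 hzv
    · exact hz.2 h3
  rw [isPreconnected_iff_subset_of_disjoint]
  intro u v hu hv huv hd
  by_cases hyv : y ∈ v
  · right
    refine key v u hv hu (by rwa [union_comm]) (by rwa [inter_comm v]) fun hyu => ?_
    exact eq_empty_iff_forall_notMem.1 hd y ⟨⟨h.right_mem, hy⟩, hyu, hyv⟩
  · exact Or.inl (key u v hu hv huv hd hyv)

/-- Adding `P` to a continuum from `p` to `y` inside the closure gives one from `x` to `y`, which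
must be all of `I`. -/
theorem exists_closure_diff (h : IrreducibleBetween I x y) {P : Set X} (hP : IsClosed P)
    (hPc : IsPreconnected P) (hPI : P ⊆ I) (hx : x ∈ P) (hy : y ∉ P) :
    ∃ p ∈ P, IrreducibleBetween (closure (I \ P)) p y := by
  have hRI : closure (I \ P) ⊆ I := closure_minimal sdiff_subset h.isClosed
  obtain ⟨p, -, hpP, hpR⟩ := isPreconnected_closed_iff.1 h.isPreconnected P (closure (I \ P)) hP
    isClosed_closure (fun z hz => by
      by_cases hzP : z ∈ P
      · exact Or.inl hzP
      · exact Or.inr (subset_closure ⟨hz, hzP⟩))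
    ⟨x, h.left_mem, hx⟩ ⟨y, h.right_mem, subset_closure ⟨h.right_mem, hy⟩⟩
  refine ⟨p, hpP, isClosed_closure, (h.isPreconnected_diff hP hPc hPI hx hy).closure, hpR,
    subset_closure ⟨h.right_mem, hy⟩, ?_⟩
  intro K hK hKc hKp hpK hyK
  have h1 := h.minimal (P ∪ K) (union_subset hPI (hK.trans hRI)) (hP.union hKc)
    (hPc.union p hpP hpK hKp) (Or.inl hx) (Or.inr hyK)
  exact closure_minimal (fun z hz => (h1 hz.1).resolve_left hz.2) hKc

/-- An irreducible continuum in which an open set avoids all indecomposable subcontinua splits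
into two continua neither of which contains the open set. -/
theorem exists_decomposition [CompactSpace X] [T2Space X] (h : IrreducibleBetween I x y)
    {V : Set X} (hV : IsOpen V) (hVne : V.Nonempty) (hVI : V ⊆ I) (hx : x ∉ V) (hy : y ∉ V)
    (hind : ∀ K : Set X, V ⊆ K → ¬ IsIndecomposableSubcontinuum K) :
    ∃ A B : Set X, IsClosed A ∧ IsPreconnected A ∧ IsClosed B ∧ IsPreconnected B ∧ A ∪ B = I ∧
      x ∈ A ∧ y ∈ B ∧ ¬ V ⊆ A ∧ ¬ V ⊆ B := by
  obtain ⟨w, hw⟩ := hVne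
  -- the part of `I` accessible from `x` without entering `V`
  obtain ⟨P, hPdef⟩ : ∃ P, P = connectedComponentIn (I \ V) x := ⟨_, rfl⟩
  have hPV : P ⊆ I \ V := hPdef ▸ connectedComponentIn_subset _ _
  have hP : IsClosed P := hPdef ▸ isClosed_connectedComponentIn_of_isClosed (h.isClosed.sdiff hV) _
  have hPc : IsPreconnected P := hPdef ▸ isPreconnected_connectedComponentIn
  have hxP : x ∈ P := hPdef ▸ mem_connectedComponentIn ⟨h.left_mem, hx⟩
  have hPI : P ⊆ I := hPV.trans sdiff_subset
  have hyP : y ∉ P := fun hyP => (hPV (h.minimal P hPI hP hPc hxP hyP (hVI hw))).2 hw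
  obtain ⟨p, hpP, hR⟩ := h.exists_closure_diff hP hPc hPI hxP hyP
  obtain ⟨R, hRdef⟩ : ∃ R, R = closure (I \ P) := ⟨_, rfl⟩
  rw [← hRdef] at hR
  have hRI : R ⊆ I := hRdef ▸ closure_minimal sdiff_subset h.isClosed
  have hIPR : I \ P ⊆ R := hRdef ▸ subset_closure
  have hVR : V ⊆ R := fun z hz => hIPR ⟨hVI hz, fun hzP => (hPV hzP).2 hz⟩
  have hRmin : ∀ K, IsClosed K → I \ P ⊆ K → R ⊆ K := fun K hK hs => hRdef ▸ closure_minimal hs hK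
  -- the part of `R` accessible from `y` without entering `V`
  obtain ⟨Q, hQdef⟩ : ∃ Q, Q = connectedComponentIn (R \ V) y := ⟨_, rfl⟩
  have hQV : Q ⊆ R \ V := hQdef ▸ connectedComponentIn_subset _ _
  have hQ : IsClosed Q := hQdef ▸ isClosed_connectedComponentIn_of_isClosed (hR.isClosed.sdiff hV) _
  have hQc : IsPreconnected Q := hQdef ▸ isPreconnected_connectedComponentIn
  have hyQ : y ∈ Q := hQdef ▸ mem_connectedComponentIn ⟨hR.right_mem, hy⟩
  have hQR : Q ⊆ R := hQV.trans sdiff_subset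
  have hpQ : p ∉ Q := by
    intro hpQ
    have := h.minimal (P ∪ Q) (union_subset hPI (hQR.trans hRI)) (hP.union hQ)
      (hPc.union p hpP hpQ hQc) (Or.inl hxP) (Or.inr hyQ) (hVI hw)
    exact this.elim (fun h => (hPV h).2 hw) (fun h => (hQV h).2 hw)
  obtain ⟨q, hqQ, hJ⟩ := hR.symm.exists_closure_diff hQ hQc hQR hyQ hpQ
  obtain ⟨J, hJdef⟩ : ∃ J, J = closure (R \ Q) := ⟨_, rfl⟩
  rw [← hJdef] at hJ
  have hJR : J ⊆ R := hJdef ▸ closure_minimal sdiff_subset hR.isClosed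
  have hRQJ : R \ Q ⊆ J := hJdef ▸ subset_closure
  have hVJ : V ⊆ J := fun z hz => hRQJ ⟨hVR hz, fun hzQ => (hQV hzQ).2 hz⟩
  have hJmin : ∀ K, IsClosed K → R \ Q ⊆ K → J ⊆ K := fun K hK hs => hJdef ▸ closure_minimal hs hK
  -- With both ends trimmed, `J` is irreducible between `q` and `p` and still contains `V`, so it is
  -- decomposable.
  have hdec : ∃ C D : Set X, IsSubcontinuum C ∧ IsSubcontinuum D ∧ C ⊂ J ∧ D ⊂ J ∧ C ∪ D = J := by
    by_contra hcon
    exact hind J hVJ ⟨⟨hJ.isClosed.isCompact, ⟨q, hJ.left_mem⟩, hJ.isPreconnected⟩, hcon⟩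
  have hdec' : ∃ C D : Set X, IsSubcontinuum C ∧ IsSubcontinuum D ∧ C ⊂ J ∧ D ⊂ J ∧ C ∪ D = J ∧
      p ∈ C := by
    obtain ⟨C, D, hC, hD, hCJ, hDJ, hCD⟩ := hdec
    have hp : p ∈ C ∪ D := hCD ▸ hJ.right_mem
    rcases hp with hp | hp
    · exact ⟨C, D, hC, hD, hCJ, hDJ, hCD, hp⟩
    · exact ⟨D, C, hD, hC, hDJ, hCJ, by rwa [union_comm], hp⟩
  obtain ⟨C, D, hC, hD, hCJ, hDJ, hCD, hpC⟩ := hdec'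
  have hCcl := hC.1.isClosed
  have hDcl := hD.1.isClosed
  have hqC : q ∉ C := fun hqC => hCJ.2 (hJ.minimal C hCJ.1 hCcl hC.2.isPreconnected hqC hpC)
  have hqD : q ∈ D := (hCD.symm ▸ hJ.left_mem : q ∈ C ∪ D).resolve_left hqC
  have hAcl := hP.union hCcl
  have hAc : IsPreconnected (P ∪ C) := hPc.union p hpP hpC hC.2.isPreconnected
  have hAI : P ∪ C ⊆ I := union_subset hPI ((hCJ.1.trans hJR).trans hRI)
  have hBcl := hDcl.union hQ
  have hBc : IsPreconnected (D ∪ Q) := hD.2.isPreconnected.union q hqD hqQ hQc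
  have hBI : D ∪ Q ⊆ I := union_subset ((hDJ.1.trans hJR).trans hRI) (hQR.trans hRI)
  -- neither piece may carry all of `I` outside `P` and `Q`
  have hCno : ¬ I \ P ⊆ C ∪ Q := by
    intro hs
    have h1 := hRmin _ (hCcl.union hQ) hs
    exact hCJ.2 (hJmin C hCcl fun z hz => (h1 hz.1).resolve_right hz.2)
  have hDno : ¬ I \ P ⊆ D ∪ Q := by
    intro hs
    have h1 := hRmin _ hBcl hs
    exact hDJ.2 (hJmin D hDcl fun z hz => (h1 hz.1).resolve_right hz.2)
  have hyA : y ∉ P ∪ C := by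
    intro hyA
    have h1 := h.minimal _ hAI hAcl hAc (Or.inl hxP) hyA
    exact hCno fun z hz => Or.inl ((h1 hz.1).resolve_left hz.2)
  have hxB : x ∉ D ∪ Q := by
    intro hxB
    have h1 := h.minimal _ hBI hBcl hBc hxB (Or.inr hyQ)
    exact hDno fun z hz => h1 hz.1
  refine ⟨P ∪ C, D ∪ Q, hAcl, hAc, hBcl, hBc, ?_, Or.inl hxP, Or.inr hyQ, ?_, ?_⟩
  · refine subset_antisymm (union_subset hAI hBI) fun z hz => ?_
    by_cases hzP : z ∈ P
    · exact Or.inl (Or.inl hzP)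
    by_cases hzQ : z ∈ Q
    · exact Or.inr (Or.inr hzQ)
    have hzJ : z ∈ C ∪ D := hCD.symm ▸ hRQJ ⟨hIPR ⟨hz, hzP⟩, hzQ⟩
    rcases hzJ with h1 | h1
    · exact Or.inl (Or.inr h1)
    · exact Or.inr (Or.inl h1)
  -- If `V` lay in `P ∪ C`, the connected remainder of `I` would contain `y` and miss `V`, hence lie
  -- in `Q`, against `hCno`. The other case is symmetric.
  · intro hVA
    have h1 := h.isPreconnected_diff hAcl hAc hAI (Or.inl hxP) hyA
    have h2 : I \ (P ∪ C) ⊆ Q := hQdef ▸ h1.subset_connectedComponentIn ⟨h.right_mem, hyA⟩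
      fun z hz => ⟨hIPR ⟨hz.1, fun hzP => hz.2 (Or.inl hzP)⟩, fun hzV => hz.2 (hVA hzV)⟩
    refine hCno fun z hz => ?_
    by_cases hzC : z ∈ C
    · exact Or.inl hzC
    · exact Or.inr (h2 ⟨hz.1, fun h => h.elim hz.2 hzC⟩)
  · intro hVB
    have h1 := h.symm.isPreconnected_diff hBcl hBc hBI (Or.inr hyQ) hxB
    have h2 : I \ (D ∪ Q) ⊆ P := hPdef ▸ h1.subset_connectedComponentIn ⟨h.left_mem, hxB⟩
      fun z hz => ⟨hz.1, fun hzV => hz.2 (hVB hzV)⟩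
    refine hDno fun z hz => ?_
    by_contra hzB
    exact hz.2 (h2 ⟨hz.1, hzB⟩)

/-- If `I` lies in every continuum joining `x` to `y` and contains an open set `V` avoiding
indecomposable continua, then `y` has a closed connected neighbourhood missing part of `V`. -/
theorem exists_nhds [CompactSpace X] [T2Space X] [PreconnectedSpace X]
    (h : IrreducibleBetween I x y)
    (hmin : ∀ K : Set X, IsClosed K → IsPreconnected K → x ∈ K → y ∈ K → I ⊆ K)
    {V : Set X} (hV : IsOpen V) (hVne : V.Nonempty) (hVI : V ⊆ I) (hx : x ∉ V) (hy : y ∉ V)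
    (hind : ∀ U : Set X, IsOpen U → U.Nonempty → ∀ K : Set X, U ⊆ K →
      ¬ IsIndecomposableSubcontinuum K) :
    ∃ K ∈ 𝓝 y, IsClosed K ∧ IsPreconnected K ∧
      ∃ W : Set X, IsOpen W ∧ W.Nonempty ∧ W ⊆ V ∧ Disjoint W K := by
  obtain ⟨A, B, hA, hAc, hB, hBc, hAB, hxA, hyB, hVA, hVB⟩ :=
    h.exists_decomposition hV hVne hVI hx hy (hind V hV hVne)
  obtain ⟨a, haV, haA⟩ := not_subset.1 hVA
  obtain ⟨b, hbV, hbB⟩ := not_subset.1 hVB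
  obtain ⟨V₂, hV₂, haV₂, hV₂A⟩ : ∃ V₂, IsOpen V₂ ∧ a ∈ V₂ ∧ closure V₂ ⊆ V \ A := by
    obtain ⟨t, ht, htc, hts⟩ :=
      exists_mem_nhds_isClosed_subset ((hV.sdiff hA).mem_nhds ⟨haV, haA⟩)
    exact ⟨interior t, isOpen_interior, mem_interior_iff_mem_nhds.2 ht,
      (closure_minimal interior_subset htc).trans hts⟩
  have hV₂B : closure V₂ ⊆ B := fun z hz => by
    have hz' := hV₂A hz
    have : z ∈ A ∪ B := hAB ▸ hVI hz'.1
    exact this.resolve_left hz'.2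
  have hF : IsClosed (V₂ᶜ) := hV₂.isClosed_compl
  have hyV₂ : y ∉ closure V₂ := fun hyV => hy (hV₂A hyV).1
  have hxV₂ : x ∉ V₂ := fun hxV => hx (hV₂A (subset_closure hxV)).1
  -- Every continuum from `x` to `y` contains `V₂`, so removing `V₂` puts `x` and `y` in different
  -- components.
  obtain ⟨S, T, hS, hT, hST, hSTF, hxS, hyT⟩ :=
    exists_isClosed_partition_of_notMem_connectedComponentIn hF hxV₂
      (fun h => hyV₂ (subset_closure h) : y ∈ V₂ᶜ) (by
        intro hyc
        have h1 := hmin _ (isClosed_connectedComponentIn_of_isClosed hF x)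
          isPreconnected_connectedComponentIn (mem_connectedComponentIn hxV₂) hyc
        exact connectedComponentIn_subset _ _ (h1 (hVI haV)) haV₂)
  have hAS : A ⊆ S := by
    have hAF : A ⊆ S ∪ T := hSTF ▸ fun z hz hzV => (hV₂A (subset_closure hzV)).2 hz
    refine ((isPreconnected_iff_subset_of_fully_disjoint_closed hA).1 hAc S T hS hT hAF
      hST).resolve_right fun hAT => ?_
    exact Set.disjoint_left.1 hST hxS (hAT hxA)
  have hxB : x ∉ B := fun hxB => hbB (hmin B hB hBc hxB hyB (hVI hbV))
  -- `T` is a neighbourhood of `y`, and `B` contains `closure V₂`, the only place where `T` can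
  -- touch the rest of the space. A piece of `T ∪ B` separated from `B` would thus be clopen in `X`.
  -- The set `V \ B` lies in `A ⊆ S`, away from `T`.
  refine ⟨T ∪ B, ?_, hT.union hB, ?_, V \ B, hV.sdiff hB, ⟨b, hbV, hbB⟩, sdiff_subset, ?_⟩
  · have h1 : (closure V₂)ᶜ ∩ Sᶜ ∈ 𝓝 y := Filter.inter_mem
      (isClosed_closure.isOpen_compl.mem_nhds hyV₂)
      (hS.isOpen_compl.mem_nhds fun hyS => Set.disjoint_left.1 hST hyS hyT)
    refine Filter.mem_of_superset h1 ?_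
    rintro z ⟨hz1, hz2⟩
    have : z ∈ S ∪ T := hSTF ▸ fun hz => hz1 (subset_closure hz)
    exact Or.inl (this.resolve_left hz2)
  · rw [isPreconnected_iff_subset_of_fully_disjoint_closed (hT.union hB)]
    have key : ∀ a b : Set X, IsClosed a → IsClosed b → T ∪ B ⊆ a ∪ b → Disjoint a b →
        B ⊆ a → T ∪ B ⊆ a := by
      intro a b ha hb hab hd hBa
      have h1 := isPreconnected_iff_subset_of_fully_disjoint_closed isClosed_univ |>.1
        (isPreconnected_univ (α := X)) (S ∪ closure V₂ ∪ (T ∪ B) ∩ a) ((T ∪ B) ∩ b)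
        ((hS.union isClosed_closure).union ((hT.union hB).inter ha)) ((hT.union hB).inter hb) ?_ ?_
      · rcases h1 with h1 | h1
        · intro z hz
          refine (hab hz).resolve_right fun hzb => ?_
          have hzT : z ∈ T := hz.resolve_right fun hzB => Set.disjoint_left.1 hd (hBa hzB) hzb
          rcases h1 (mem_univ z) with (h2 | h2) | h2
          · exact Set.disjoint_left.1 hST h2 hzT
          · exact Set.disjoint_left.1 hd (hBa (hV₂B h2)) hzb
          · exact Set.disjoint_left.1 hd h2.2 hzb
        · have := h1 (mem_univ x)
          exact (this.1.elim (fun h => Set.disjoint_left.1 hST hxS h) hxB).elim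
      · intro z _
        by_cases hzV : z ∈ V₂
        · exact Or.inl (Or.inl (Or.inr (subset_closure hzV)))
        have : z ∈ S ∪ T := hSTF ▸ hzV
        rcases this with h2 | h2
        · exact Or.inl (Or.inl (Or.inl h2))
        · rcases hab (Or.inl h2) with h3 | h3
          · exact Or.inl (Or.inr ⟨Or.inl h2, h3⟩)
          · exact Or.inr ⟨Or.inl h2, h3⟩
      · rw [Set.disjoint_left]
        rintro z ((h2 | h2) | h2) ⟨h3, h4⟩
        · exact h3.elim (fun h => Set.disjoint_left.1 hST h2 h)
            fun h => Set.disjoint_left.1 hd (hBa h) h4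
        · exact Set.disjoint_left.1 hd (hBa (hV₂B h2)) h4
        · exact Set.disjoint_left.1 hd h2.2 h4
    intro a b ha hb hab hd
    rcases (isPreconnected_iff_subset_of_fully_disjoint_closed hB).1 hBc a b ha hb
      (subset_union_right.trans hab) hd with h1 | h1
    · exact Or.inl (key a b ha hb hab hd h1)
    · exact Or.inr (key b a hb ha (by rwa [union_comm b]) hd.symm h1)
  · rw [Set.disjoint_left]
    rintro z ⟨hzV, hzB⟩ (hzT | hzB')
    · have : z ∈ A ∪ B := hAB ▸ hVI hzV
      exact Set.disjoint_left.1 hST (hAS (this.resolve_right hzB)) hzT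
    · exact hzB hzB'

end IrreducibleBetween

/-! ### Least continua in hereditarily unicoherent spaces -/

theorem isPreconnected_sInter_of_directedOn {X : Type*} [TopologicalSpace X] [CompactSpace X]
    [T2Space X] {S : Set (Set X)} (hne : S.Nonempty) (hd : DirectedOn (· ⊇ ·) S)
    (hcl : ∀ K ∈ S, IsClosed K) (hc : ∀ K ∈ S, IsPreconnected K) : IsPreconnected (⋂₀ S) := by
  have hI : IsClosed (⋂₀ S) := isClosed_sInter hcl
  rw [isPreconnected_iff_subset_of_fully_disjoint_closed hI]
  intro u v hu hv huv hdis
  obtain ⟨u', v', hu', hv', huu, hvv, hdis'⟩ := normal_separation hu hv hdis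
  have := hne.to_subtype
  obtain ⟨⟨K, hK⟩, hKuv⟩ := exists_subset_nhds_of_compactSpace (V := fun K : S => (K : Set X))
    (directedOn_iff_directed.1 hd) (fun K => hcl K K.2) (U := u' ∪ v') (by
      rw [← sInter_eq_iInter]
      exact fun z hz => (hu'.union hv').mem_nhds (union_subset_union huu hvv (huv hz)))
  rcases isPreconnected_iff_subset_of_disjoint.1 (hc K hK) u' v' hu' hv' hKuv
    (by rw [hdis'.inter_eq, inter_empty]) with h | h
  · exact Or.inl fun z hz => (huv hz).resolve_right fun hzv =>
      Set.disjoint_left.1 hdis' (h (hz K hK)) (hvv hzv)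
  · exact Or.inr fun z hz => (huv hz).resolve_left fun hzu =>
      Set.disjoint_left.1 hdis' (huu hzu) (h (hz K hK))

namespace HereditarilyUnicoherent

variable {X : Type*} [TopologicalSpace X]

theorem isPreconnected_biInter (hX : HereditarilyUnicoherent X) [PreconnectedSpace X]
    {ι : Type*} (t : Finset ι) (K : ι → Set X) (hcl : ∀ i ∈ t, IsClosed (K i))
    (hc : ∀ i ∈ t, IsPreconnected (K i)) : IsPreconnected (⋂ i ∈ t, K i) := by
  classical
  induction t using Finset.induction_on with
  | empty => simpa using isPreconnected_univ
  | insert a s ha ih =>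
    rw [Finset.set_biInter_insert]
    exact hX _ _ (hcl a (Finset.mem_insert_self _ _))
      (isClosed_biInter fun i hi => hcl i (Finset.mem_insert_of_mem hi))
      (hc a (Finset.mem_insert_self _ _))
      (ih (fun i hi => hcl i (Finset.mem_insert_of_mem hi))
        fun i hi => hc i (Finset.mem_insert_of_mem hi))

/-- Closed connected sets through `x` and `y` are stable under pairwise intersection, so by
compactness the intersection of all of them is connected. -/
theorem exists_irreducibleBetween (hX : HereditarilyUnicoherent X) [CompactSpace X] [T2Space X]
    [PreconnectedSpace X] (x y : X) : ∃ I : Set X, IrreducibleBetween I x y ∧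
      ∀ K : Set X, IsClosed K → IsPreconnected K → x ∈ K → y ∈ K → I ⊆ K := by
  let S : Set (Set X) := {K | IsClosed K ∧ IsPreconnected K ∧ x ∈ K ∧ y ∈ K}
  have hmin : ∀ K : Set X, IsClosed K → IsPreconnected K → x ∈ K → y ∈ K → ⋂₀ S ⊆ K :=
    fun K h1 h2 h3 h4 => sInter_subset_of_mem ⟨h1, h2, h3, h4⟩
  refine ⟨⋂₀ S, ⟨isClosed_sInter fun K hK => hK.1, ?_, fun K hK => hK.2.2.1,
    fun K hK => hK.2.2.2, fun K _ => hmin K⟩, hmin⟩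
  refine isPreconnected_sInter_of_directedOn
    ⟨univ, isClosed_univ, isPreconnected_univ, mem_univ _, mem_univ _⟩ ?_
    (fun K hK => hK.1) fun K hK => hK.2.1
  exact fun A hA B hB => ⟨A ∩ B, ⟨hA.1.inter hB.1, hX A B hA.1 hB.1 hA.2.1 hB.2.1,
    ⟨hA.2.2.1, hB.2.2.1⟩, ⟨hA.2.2.2, hB.2.2.2⟩⟩, inter_subset_left, inter_subset_right⟩

end HereditarilyUnicoherent

/-- Under the hypothesis on indecomposable continua this makes points nowhere dense, so that each x
lies in M_x. -/
theorem isIndecomposableSubcontinuum_singleton {X : Type*} [TopologicalSpace X] (x : X) :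
    IsIndecomposableSubcontinuum ({x} : Set X) := by
  refine ⟨⟨isCompact_singleton, isConnected_singleton⟩, ?_⟩
  rintro ⟨A, B, hA, -, hAx, -, -⟩
  exact hAx.2 (singleton_subset_iff.2 (by
    obtain ⟨a, ha⟩ := hA.2.nonempty
    rwa [← mem_singleton_iff.1 (hAx.1 ha)]))

theorem IsNowhereDense.union_of_isClosed {X : Type*} [TopologicalSpace X] {s t : Set X}
    (hs : IsNowhereDense s) (ht : IsNowhereDense t) (hsc : IsClosed s) (htc : IsClosed t) :
    IsNowhereDense (s ∪ t) := by
  rw [IsNowhereDense, hsc.closure_eq] at hs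
  rw [IsNowhereDense, htc.closure_eq] at ht
  rw [IsNowhereDense, (hsc.union htc).closure_eq,
    interior_union_isClosed_of_interior_empty hsc ht, hs]

/-! ### Meager composants as equivalence classes -/

section MeagerComposant

variable {X : Type*} [TopologicalSpace X]

theorem mem_meagerComposant {x y : X} : y ∈ meagerComposant x ↔
    ∃ L : Set X, IsSubcontinuum L ∧ IsNowhereDense L ∧ x ∈ L ∧ y ∈ L := by
  simp only [meagerComposant, mem_sUnion, mem_ofPred_eq, and_assoc]

theorem mem_meagerComposant_comm {x y : X} : y ∈ meagerComposant x ↔ x ∈ meagerComposant y := by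
  simp only [mem_meagerComposant, and_comm (a := x ∈ _)]

theorem mem_meagerComposant_trans [T2Space X] {x y z : X} (hxy : y ∈ meagerComposant x)
    (hyz : z ∈ meagerComposant y) : z ∈ meagerComposant x := by
  obtain ⟨L, hL, hLn, hxL, hyL⟩ := mem_meagerComposant.1 hxy
  obtain ⟨K, hK, hKn, hyK, hzK⟩ := mem_meagerComposant.1 hyz
  exact mem_meagerComposant.2 ⟨L ∪ K, ⟨hL.1.union hK.1, hL.2.union ⟨y, hyL, hyK⟩ hK.2⟩,
    hLn.union_of_isClosed hKn hL.1.isClosed hK.1.isClosed, Or.inl hxL, Or.inr hzK⟩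

theorem isPreconnected_meagerComposant (x : X) : IsPreconnected (meagerComposant x) :=
  isPreconnected_sUnion x _ (fun _ h => h.2.2) fun _ h => h.1.2.isPreconnected

end MeagerComposant

/-! ### Images under closed and monotone maps -/

section ClosedMap

variable {X Y : Type*} [TopologicalSpace X] [TopologicalSpace Y] {f : X → Y}

theorem IsClosedMap.t2Space_of_surjective [CompactSpace X] [T2Space X] (hf : IsClosedMap f)
    (hc : Continuous f) (hs : Function.Surjective f) (hfib : ∀ y, IsClosed (f ⁻¹' {y})) :
    T2Space Y := by
  rw [t2Space_iff_disjoint_nhds]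
  intro y z hyz
  rw [← Filter.disjoint_comap_iff hs, hf.comap_nhds_eq hc, hf.comap_nhds_eq hc]
  exact (SeparatedNhds.of_isCompact_isCompact (hfib y).isCompact (hfib z).isCompact
    (Disjoint.preimage f (disjoint_singleton.2 hyz))).disjoint_nhdsSet

/-- The base consists of the sets of points whose fibre lies in a given finite union of basic open
sets; finite unions suffice because fibres are compact. -/
theorem IsClosedMap.secondCountableTopology_of_surjective [CompactSpace X]
    [SecondCountableTopology X] (hf : IsClosedMap f) (hc : Continuous f)
    (hs : Function.Surjective f) (hfib : ∀ y, IsClosed (f ⁻¹' {y})) :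
    SecondCountableTopology Y := by
  let B := TopologicalSpace.countableBasis X
  let C : Set (Set Y) := (fun F : Set (Set X) => (f '' (⋃₀ F)ᶜ)ᶜ) '' {F | F.Finite ∧ F ⊆ B}
  have hB := TopologicalSpace.isBasis_countableBasis X
  have hopen : ∀ F : Set (Set X), F ⊆ B → IsOpen (⋃₀ F) := fun F hF =>
    isOpen_sUnion fun u hu => hB.isOpen (hF hu)
  have hC : TopologicalSpace.IsTopologicalBasis C := by
    refine TopologicalSpace.isTopologicalBasis_of_isOpen_of_nhds ?_ ?_
    · rintro _ ⟨F, ⟨-, hF⟩, rfl⟩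
      exact (hf _ (hopen F hF).isClosed_compl).isOpen_compl
    · intro y u hy hu
      have h1 : ∀ x ∈ f ⁻¹' {y}, ∃ b ∈ B, x ∈ b ∧ b ⊆ f ⁻¹' u := fun x hx =>
        hB.exists_subset_of_mem_open (by rw [mem_preimage, hx]; exact hy) (hu.preimage hc)
      choose! b hbB hxb hbu using h1
      obtain ⟨t, ht, hcov⟩ := (hfib y).isCompact.elim_nhds_subcover b fun x hx =>
        (hB.isOpen (hbB x hx)).mem_nhds (hxb x hx)
      refine ⟨_, ⟨b '' (t : Set X), ⟨t.finite_toSet.image b, ?_⟩, rfl⟩, ?_, ?_⟩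
      · rintro _ ⟨x, hx, rfl⟩
        exact hbB x (ht x hx)
      · rintro ⟨x, hx, hxy⟩
        refine hx ?_
        rw [sUnion_image]
        exact hcov hxy
      · intro z hz
        obtain ⟨x, rfl⟩ := hs z
        by_contra hzu
        refine hz ⟨x, ?_, rfl⟩
        rintro ⟨_, ⟨w, hw, rfl⟩, hxw⟩
        exact hzu (hbu w (ht w hw) hxw)
  exact hC.secondCountableTopology
    ((countable_ofPred_finite_subset (TopologicalSpace.countable_countableBasis X)).image _)

/-- Preimages of closed connected sets are connected, so the intersection can be taken upstairs and
mapped down. -/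
theorem HereditarilyUnicoherent.of_monotone_isClosedMap (hX : HereditarilyUnicoherent X)
    (hf : IsClosedMap f) (hc : Continuous f) (hfib : ∀ y, IsConnected (f ⁻¹' {y})) :
    HereditarilyUnicoherent Y := by
  have hs : Function.Surjective f := fun y => (hfib y).nonempty
  have hpre : ∀ A : Set Y, IsClosed A → IsPreconnected A → IsPreconnected (f ⁻¹' A) := by
    intro A hA hAc
    rcases A.eq_empty_or_nonempty with rfl | hne
    · rw [preimage_empty]; exact isPreconnected_empty
    · exact ((hf.isQuotientMap hc hs).isCoinducing.isConnected_preimage_of_isClosed hfib hA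
        ⟨hne, hAc⟩).isPreconnected
  intro A B hA hB hAc hBc
  have h1 := (hX _ _ (hA.preimage hc) (hB.preimage hc) (hpre A hA hAc) (hpre B hB hBc)).image f
    hc.continuousOn
  rwa [← preimage_inter, image_preimage_eq _ hs] at h1

end ClosedMap

/-- Two closed half-circles are connected but meet in exactly two points. -/
theorem HereditarilyUnicoherent.not_exists_circle_embedding {Y : Type*} [TopologicalSpace Y]
    [T2Space Y] (hY : HereditarilyUnicoherent Y) : ¬ ∃ γ : Circle → Y, IsEmbedding γ := by
  rintro ⟨γ, hγ⟩
  have hg : Continuous fun t : ℝ => γ (Circle.exp t) := hγ.continuous.comp Circle.exp.continuous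
  have hpi := Real.pi_pos
  have hcl : ∀ a b : ℝ, IsClosed ((fun t : ℝ => γ (Circle.exp t)) '' Icc a b) := fun a b =>
    (isCompact_Icc.image hg).isClosed
  have hcn : ∀ a b : ℝ, IsPreconnected ((fun t : ℝ => γ (Circle.exp t)) '' Icc a b) := fun a b =>
    isPreconnected_Icc.image _ hg.continuousOn
  have h1 := hY _ _ (hcl 0 Real.pi) (hcl (-Real.pi) 0) (hcn _ _) (hcn _ _)
  have hexp : Circle.exp (-Real.pi) = Circle.exp Real.pi :=
    Circle.exp_eq_exp.2 ⟨-1, by push_cast; ring⟩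
  have hne : γ (Circle.exp 0) ≠ γ (Circle.exp Real.pi) := by
    intro h
    obtain ⟨m, hm⟩ := Circle.exp_eq_exp.1 (hγ.injective h)
    have h2 : ((2 * m + 1 : ℤ) : ℝ) = 0 := by
      push_cast
      have : Real.pi * (2 * m + 1) = 0 := by linarith
      exact (mul_eq_zero.1 this).resolve_left hpi.ne'
    have h3 : 2 * m + 1 = 0 := by exact_mod_cast h2
    omega
  obtain ⟨z, -, hz⟩ := isPreconnected_closed_iff.1 h1 {γ (Circle.exp 0)} {γ (Circle.exp Real.pi)}
    isClosed_singleton isClosed_singleton (by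
      rintro _ ⟨⟨a, ha, rfl⟩, ⟨b, hb, hab⟩⟩
      obtain ⟨m, hm⟩ := Circle.exp_eq_exp.1 (hγ.injective hab)
      -- Here `b = a + 2πm` with `b - a ∈ [-2π, 0]`, so `m = 0` forces `a = 0` and `m = -1` forces
      -- `a = π`.
      have hm0 : -1 ≤ m := by
        have : (-2 : ℝ) < m := by nlinarith [ha.1, ha.2, hb.1, hb.2]
        have : (-2 : ℤ) < m := by exact_mod_cast this
        omega
      have hm1 : m ≤ 0 := by
        have : (m : ℝ) < 1 := by nlinarith [ha.1, ha.2, hb.1, hb.2]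
        have : m < (1 : ℤ) := by exact_mod_cast this
        omega
      have hm2 : m = 0 ∨ m = -1 := by omega
      rcases hm2 with rfl | rfl
      · left
        push_cast at hm
        have : a = 0 := by linarith [ha.1, hb.2]
        simp [this]
      · right
        push_cast at hm
        have : a = Real.pi := by linarith [ha.2, hb.1]
        simp [this])
    ⟨_, ⟨⟨0, ⟨le_rfl, hpi.le⟩, rfl⟩, ⟨0, ⟨by linarith, le_rfl⟩, rfl⟩⟩, rfl⟩
    ⟨_, ⟨⟨Real.pi, ⟨hpi.le, le_rfl⟩, rfl⟩,
      ⟨-Real.pi, ⟨le_rfl, by linarith⟩, by simp only [hexp]⟩⟩, rfl⟩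
  exact hne (hz.1.symm.trans hz.2)

/-! ### Separating and enclosing meager composants -/

section MeagerComposant

variable {X : Type*} [TopologicalSpace X]

/-- The equivalence relation whose classes are the meager composants. -/
def meagerComposantSetoid [T2Space X] (h : ∀ x : X, IsNowhereDense ({x} : Set X)) : Setoid X where
  r x y := y ∈ meagerComposant x
  iseqv :=
    { refl := fun x => mem_meagerComposant.2
        ⟨{x}, ⟨isCompact_singleton, isConnected_singleton⟩, h x, rfl, rfl⟩
      symm := fun h => mem_meagerComposant_comm.1 h
      trans := fun h h' => mem_meagerComposant_trans h h' }

theorem HereditarilyUnicoherent.exists_nhds_of_notMem_meagerComposant [CompactSpace X] [T2Space X]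
    [PreconnectedSpace X] (hX : HereditarilyUnicoherent X)
    (hind : ∀ K : Set X, IsIndecomposableSubcontinuum K → IsNowhereDense K) {x y : X}
    (hxy : y ∉ meagerComposant x) :
    ∃ H ∈ 𝓝 x, ∃ K ∈ 𝓝 y, IsClosed H ∧ IsPreconnected H ∧ IsClosed K ∧ IsPreconnected K ∧
      ∃ W : Set X, W.Nonempty ∧ IsOpen W ∧ Disjoint W H ∧ Disjoint W K ∧
        ∀ L : Set X, IsClosed L → IsPreconnected L → x ∈ L → y ∈ L → W ⊆ L := by
  obtain ⟨I, hI, hmin⟩ := hX.exists_irreducibleBetween x y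
  have hInd : ¬ IsNowhereDense I := fun hn => hxy (mem_meagerComposant.2
    ⟨I, ⟨hI.isClosed.isCompact, ⟨x, hI.left_mem⟩, hI.isPreconnected⟩, hn, hI.left_mem,
      hI.right_mem⟩)
  have hsing : ∀ z : X, IsNowhereDense ({z} : Set X) := fun z =>
    hind _ (isIndecomposableSubcontinuum_singleton z)
  have hind' : ∀ U : Set X, IsOpen U → U.Nonempty → ∀ K : Set X, U ⊆ K →
      ¬ IsIndecomposableSubcontinuum K := by
    rintro U hU ⟨z, hz⟩ K hUK hK
    have : z ∈ interior (closure K) := interior_maximal (hUK.trans subset_closure) hU hz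
    rw [hind K hK] at this
    exact this
  have hcl : IsClosed ({x} ∪ {y} : Set X) := isClosed_singleton.union isClosed_singleton
  have hV : IsOpen (interior I \ ({x} ∪ {y})) := isOpen_interior.sdiff hcl
  have hVne : (interior I \ ({x} ∪ {y})).Nonempty := by
    rw [nonempty_iff_ne_empty]
    intro h
    have hn := (hsing x).union_of_isClosed (hsing y) isClosed_singleton isClosed_singleton
    rw [IsNowhereDense, hcl.closure_eq] at hn
    apply hInd
    rw [IsNowhereDense, hI.isClosed.closure_eq, ← subset_empty_iff, ← hn]
    exact interior_maximal (sdiff_eq_empty.1 h) isOpen_interior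
  have hVI : interior I \ ({x} ∪ {y}) ⊆ I := sdiff_subset.trans interior_subset
  obtain ⟨K, hK, hKcl, hKc, W, hW, hWne, hWV, hWK⟩ := hI.exists_nhds hmin hV hVne hVI
    (fun h => h.2 (Or.inl rfl)) (fun h => h.2 (Or.inr rfl)) hind'
  -- The second application, at `x`, starts from `W` instead of `V`, so `W'` misses both
  -- neighbourhoods.
  obtain ⟨H, hH, hHcl, hHc, W', hW', hWne', hWW', hWH⟩ := hI.symm.exists_nhds
    (fun K h1 h2 h3 h4 => hmin K h1 h2 h4 h3) hW hWne (hWV.trans hVI)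
    (fun h => (hWV h).2 (Or.inr rfl)) (fun h => (hWV h).2 (Or.inl rfl)) hind'
  exact ⟨H, hH, K, hK, hHcl, hHc, hKcl, hKc, W', hWne', hW', hWH, hWK.mono_left hWW',
    fun L h1 h2 h3 h4 => (hWW'.trans (hWV.trans hVI)).trans (hmin L h1 h2 h3 h4)⟩

theorem HereditarilyUnicoherent.isClosed_meagerComposant_rel [CompactSpace X] [T2Space X]
    [PreconnectedSpace X] (hX : HereditarilyUnicoherent X)
    (hind : ∀ K : Set X, IsIndecomposableSubcontinuum K → IsNowhereDense K) :
    IsClosed {p : X × X | p.2 ∈ meagerComposant p.1} := by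
  rw [← isOpen_compl_iff, isOpen_iff_mem_nhds]
  rintro ⟨x, y⟩ hxy
  obtain ⟨H, hH, K, hK, hHcl, hHc, hKcl, hKc, W, ⟨w, hw⟩, hW, hWH, hWK, hmin⟩ :=
    hX.exists_nhds_of_notMem_meagerComposant hind hxy
  refine Filter.mem_of_superset (prod_mem_nhds hH hK) ?_
  rintro ⟨a, b⟩ ⟨ha, hb⟩ hab
  obtain ⟨L, hL, hLn, haL, hbL⟩ := mem_meagerComposant.1 hab
  have h1 := hmin (H ∪ L ∪ K) ((hHcl.union hL.1.isClosed).union hKcl)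
    ((hHc.union a ha haL hL.2.isPreconnected).union b (Or.inr hbL) hb hKc)
    (Or.inl (Or.inl (mem_of_mem_nhds hH))) (Or.inr (mem_of_mem_nhds hK))
  have h2 : W ⊆ L := fun z hz => by
    rcases h1 hz with (h | h) | h
    · exact (Set.disjoint_left.1 hWH hz h).elim
    · exact h
    · exact (Set.disjoint_left.1 hWK hz h).elim
  have h3 : w ∈ interior (closure L) := interior_maximal (h2.trans subset_closure) hW hw
  rw [hLn] at h3
  exact h3

/-- For each point outside M_y, finitely many connected neighbourhoods avoiding it are glued along
M_y. By compactness of `Uᶜ`, finitely many of the resulting sets intersect inside `U`, and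
unicoherence keeps the intersection connected. -/
theorem HereditarilyUnicoherent.exists_isPreconnected_nhdsSet_meagerComposant [CompactSpace X]
    [T2Space X] [PreconnectedSpace X] (hX : HereditarilyUnicoherent X)
    (hind : ∀ K : Set X, IsIndecomposableSubcontinuum K → IsNowhereDense K) (y : X)
    (hy : IsClosed (meagerComposant y)) {U : Set X} (hU : IsOpen U)
    (hyU : meagerComposant y ⊆ U) :
    ∃ N ∈ 𝓝ˢ (meagerComposant y), IsPreconnected N ∧ N ⊆ U := by
  have h1 : ∀ x ∉ meagerComposant y, ∃ K ∈ 𝓝ˢ (meagerComposant y),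
      IsClosed K ∧ IsPreconnected K ∧ x ∉ K := by
    intro x hx
    have h2 : ∀ w ∈ meagerComposant y, ∃ K ∈ 𝓝 w, IsClosed K ∧ IsPreconnected K ∧ x ∉ K := by
      intro w hw
      have hwx : w ∉ meagerComposant x := fun h =>
        hx (mem_meagerComposant_trans hw (mem_meagerComposant_comm.1 h))
      obtain ⟨H, hH, K, hK, -, -, hKcl, hKc, W, ⟨z, hz⟩, -, -, hWK, hmin⟩ :=
        hX.exists_nhds_of_notMem_meagerComposant hind hwx
      exact ⟨K, hK, hKcl, hKc, fun hxK =>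
        Set.disjoint_left.1 hWK hz (hmin K hKcl hKc hxK (mem_of_mem_nhds hK) hz)⟩
    choose! K hK hKcl hKc hxK using h2
    obtain ⟨t, ht, hcov⟩ := hy.isCompact.elim_nhds_subcover (fun w => interior (K w)) fun w hw =>
      interior_mem_nhds.2 (hK w hw)
    refine ⟨⋃₀ insert (meagerComposant y) ((fun w => K w ∪ meagerComposant y) '' t), ?_, ?_, ?_, ?_⟩
    · rw [mem_nhdsSet_iff_forall]
      intro w hw
      obtain ⟨v, hv, hwv⟩ := mem_iUnion₂.1 (hcov hw)
      refine Filter.mem_of_superset (mem_interior_iff_mem_nhds.1 hwv) fun z hz => ?_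
      exact ⟨_, Or.inr ⟨v, hv, rfl⟩, Or.inl hz⟩
    · rw [sUnion_eq_biUnion]
      refine ((t.finite_toSet.image _).insert _).isClosed_biUnion ?_
      rintro _ (rfl | ⟨w, hw, rfl⟩)
      · exact hy
      · exact (hKcl w (ht w hw)).union hy
    · rcases (meagerComposant y).eq_empty_or_nonempty with he | ⟨v, hv⟩
      · have : t = ∅ := Finset.eq_empty_of_forall_notMem fun w hw => by
          have := ht w hw; rw [he] at this; exact this
        subst this
        simpa [he] using isPreconnected_empty
      refine isPreconnected_sUnion v _ ?_ ?_
      · rintro _ (rfl | ⟨w, hw, rfl⟩)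
        · exact hv
        · exact Or.inr hv
      · rintro _ (rfl | ⟨w, hw, rfl⟩)
        · exact isPreconnected_meagerComposant _
        · exact (hKc w (ht w hw)).union w (mem_of_mem_nhds (hK w (ht w hw))) (ht w hw)
            (isPreconnected_meagerComposant _)
    · rintro ⟨_, rfl | ⟨w, hw, rfl⟩, hxw⟩
      · exact hx hxw
      · exact hxw.elim (hxK w (ht w hw)) hx
  choose! K hK hKcl hKc hxK using h1
  have hns : ∀ x ∈ Uᶜ, x ∉ meagerComposant y := fun x hx h => hx (hyU h)
  obtain ⟨t, ht, hcov⟩ := hU.isClosed_compl.isCompact.elim_nhds_subcover (fun x => (K x)ᶜ)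
    fun x hx => (hKcl x (hns x hx)).isOpen_compl.mem_nhds (hxK x (hns x hx))
  refine ⟨⋂ x ∈ t, K x, ?_, hX.isPreconnected_biInter t K (fun x hx => hKcl x (hns x (ht x hx)))
    fun x hx => hKc x (hns x (ht x hx)), ?_⟩
  · exact (Filter.biInter_finset_mem t).2 fun x hx => hK x (hns x (ht x hx))
  · intro z hz
    by_contra hzU
    obtain ⟨x, hx, hzx⟩ := mem_iUnion₂.1 (hcov hzU)
    exact hzx (mem_iInter₂.1 hz x hx)

end MeagerComposant

/-! ### The decomposition and its quotient -/

theorem corollary13 (X : Type*) [MetricSpace X] [CompactSpace X] [ConnectedSpace X]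
    (hX : IsTreeLike X)
    (hind : ∀ K : Set X, IsIndecomposableSubcontinuum K → IsNowhereDense K) :
    ∃ s : Setoid X,
      s.classes = {M : Set X | ∃ x : X, M = meagerComposant x} ∧
      IsMonotoneDecomposition s ∧
      IsUpperSemicontinuousDecomposition s ∧
      IsDendrite (Quotient s) := by
  have hU := hX.hereditarilyUnicoherent
  have hsing : ∀ z : X, IsNowhereDense ({z} : Set X) := fun z =>
    hind _ (isIndecomposableSubcontinuum_singleton z)
  let s := meagerComposantSetoid hsing
  have hs : ∀ x y, s x y ↔ y ∈ meagerComposant x := fun _ _ => Iff.rfl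
  have hrel := hU.isClosed_meagerComposant_rel hind
  have hMcl : ∀ x : X, IsClosed (meagerComposant x) := fun x =>
    hrel.preimage (Continuous.prodMk_right x)
  have hMc : ∀ x : X, IsConnected (meagerComposant x) := fun x =>
    ⟨⟨x, s.refl x⟩, isPreconnected_meagerComposant x⟩
  have hclass : s.classes = {M : Set X | ∃ x : X, M = meagerComposant x} := by
    ext M
    refine exists_congr fun x => ?_
    have : {z | s z x} = meagerComposant x := by
      ext z
      exact (hs z x).trans mem_meagerComposant_comm
    rw [this]
  have hsat : ∀ A : Set X, IsClosed A → IsClosed {z | ∃ a ∈ A, z ∈ meagerComposant a} := by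
    intro A hA
    -- The saturation of `A` is the projection, along a compact factor, of a closed part of the
    -- relation.
    have h1 := isClosedMap_snd_of_compactSpace _ (hrel.inter (hA.preimage continuous_fst))
    convert h1 using 1
    ext z
    constructor
    · rintro ⟨a, ha, hz⟩
      exact ⟨(a, z), ⟨hz, ha⟩, rfl⟩
    · rintro ⟨⟨a, z⟩, ⟨hz, ha⟩, rfl⟩
      exact ⟨a, ha, hz⟩
  have hmk : ∀ x y, (Quotient.mk s x = Quotient.mk s y) ↔ y ∈ meagerComposant x :=
    fun x y => Quotient.eq
  have hfib : ∀ x, Quotient.mk s ⁻¹' {Quotient.mk s x} = meagerComposant x := by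
    intro x
    ext z
    exact (hmk z x).trans mem_meagerComposant_comm
  have hcont : Continuous (Quotient.mk s) := continuous_quotient_mk'
  have hsurj : Function.Surjective (Quotient.mk s) := Quotient.mk_surjective
  have hclosed : IsClosedMap (Quotient.mk s) := by
    intro A hA
    rw [← isQuotientMap_quotient_mk'.isClosed_preimage]
    convert hsat A hA using 1
    ext z
    exact ⟨fun ⟨a, ha, h⟩ => ⟨a, ha, (hmk a z).1 h⟩, fun ⟨a, ha, h⟩ => ⟨a, ha, (hmk a z).2 h⟩⟩
  have hfibc : ∀ q, IsConnected (Quotient.mk s ⁻¹' {q}) := fun q => by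
    obtain ⟨x, rfl⟩ := hsurj q
    rw [hfib]; exact hMc x
  have hfibcl : ∀ q, IsClosed (Quotient.mk s ⁻¹' {q}) := fun q => by
    obtain ⟨x, rfl⟩ := hsurj q
    rw [hfib]; exact hMcl x
  have hT2 : T2Space (Quotient s) := hclosed.t2Space_of_surjective hcont hsurj hfibcl
  have hsc : SecondCountableTopology (Quotient s) :=
    hclosed.secondCountableTopology_of_surjective hcont hsurj hfibcl
  -- Metrizability comes from the quotient being compact, Hausdorff and second countable.
  refine ⟨s, hclass, ?_, ?_, inferInstance, inferInstance, inferInstance, ?_,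
    (hU.of_monotone_isClosedMap hclosed hcont hfibc).not_exists_circle_embedding⟩
  · intro D hD
    rw [hclass] at hD
    obtain ⟨x, rfl⟩ := hD
    exact ⟨(hMcl x).isCompact, hMc x⟩
  · intro A hA
    convert hsat A hA using 1
    ext z
    rw [hclass]
    constructor
    · rintro ⟨_, ⟨⟨x, rfl⟩, a, hax, ha⟩, hz⟩
      exact ⟨a, ha, mem_meagerComposant_trans (mem_meagerComposant_comm.1 hax) hz⟩
    · rintro ⟨a, ha, hz⟩
      exact ⟨_, ⟨⟨a, rfl⟩, a, s.refl a, ha⟩, hz⟩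
  · rw [locallyConnectedSpace_iff_connected_subsets]
    intro q O hO
    obtain ⟨y, rfl⟩ := hsurj q
    obtain ⟨O', hO'O, hO', hyO'⟩ := mem_nhds_iff.1 hO
    obtain ⟨N, hN, hNc, hNO⟩ := hU.exists_isPreconnected_nhdsSet_meagerComposant hind y (hMcl y)
      (hO'.preimage hcont) (by
        intro z hz
        rw [← hfib] at hz
        rw [mem_preimage, hz]
        exact hyO')
    -- As the quotient map is closed, neighbourhoods of a fibre contain preimages of neighbourhoods
    -- of its point, so the image of `N` is a connected neighbourhood.
    rw [← hfib, ← hclosed.comap_nhds_eq hcont] at hN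
    obtain ⟨W, hW, hWN⟩ := hN
    refine ⟨Quotient.mk s '' N, Filter.mem_of_superset hW ?_, hNc.image _ hcont.continuousOn,
      (image_subset_iff.2 hNO).trans hO'O⟩
    intro w hw
    obtain ⟨x, rfl⟩ := hsurj w
    exact ⟨x, hWN hw, rfl⟩
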